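/- Let $X$ be a completely regular Hausdorff space and let $C(X)$ be the set of all continuous functions $X\to\mathbb{R}$, with the $U$-topology, that is, the topology of uniform convergence on $X$ (the sets $\{g\in C(X):\sup_{x\in X}|f(x)-g(x)|<\varepsilon\}$, $f\in C(X)$, $\varepsilon>0$, form an open base). For $f\in C(X)$ let $f^*:\beta X\to\mathbb{R}\cup\{\infty\}$ be the continuous extension of $f$ to the Stone–Čech compactification $\beta X$, with values in the one-point compactification of $\mathbb{R}$. Let $\upsilon X=\{p\in\beta X: f^*(p)\neq\infty\text{ for all }f\in C(X)\}$ be the Hewitt realcompactification of $X$, and for $p\in\beta X$ put $\widetilde{M}^p=\{f\in C(X):f^*(p)=0\}$. Let $C_\psi(X)$ be the set of all $f\in C(X)$ whose support $\mathrm{cl}_X\{x: f(x)\ne 0\}$ is pseudocompact (every real-valued continuous function on it is bounded). Let $C^\psi_\infty(X)$ be the set of all $f\in C(X)$ such that for every integer $n\ge 1$ the set $\{x\in X:|f(x)|\geq \frac1n\}$ is bounded in $X$ (relatively pseudocompact), meaning that each $g\in C(X)$ is bounded on it. Then the closure $\mathrm{cl}_U C_\psi(X)$ of $C_\psi(X)$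 in the $U$-topology satisfies $$\mathrm{cl}_U C_\psi(X)=\bigcap_{p\in\beta X\setminus\upsilon X}\widetilde{M}^p=\{f\in C(X): f^*(\beta X\setminus\upsilon X)\subseteq\{0\}\}\quad\text{and}\quad \mathrm{cl}_U C_\psi(X)=C^\psi_\infty(X).$$ (If $\upsilon X=\beta X$, the intersection over the empty index set is $C(X)$.) -/

import Mathlib

namespace UClosure

/-- A space is pseudocompact if every real valued continuous function on it is bounded. -/
def IsPseudocompactSpace (Y : Type*) [TopologicalSpace Y] : Prop :=
  ∀ g : C(Y, ℝ), Bornology.IsBounded (Set.range g)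

/-- A subset `S` of `X` is bounded (relatively pseudocompact) in `X` if every real valued
continuous function on the whole of `X` is bounded on `S`. -/
def IsRelPseudocompact {X : Type*} [TopologicalSpace X] (S : Set X) : Prop :=
  ∀ g : C(X, ℝ), Bornology.IsBounded (g '' S)

/-- The `U`-topology on `C(X)`: the topology of uniform convergence on all of `X`. -/
abbrev uTopology (X : Type*) [TopologicalSpace X] : TopologicalSpace C(X, ℝ) :=
  TopologicalSpace.induced (fun f : C(X, ℝ) => UniformFun.ofFun (f : X → ℝ)) inferInstance

/-- The closure of a subset of `C(X)` in the `U`-topology. -/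
def uClosure {X : Type*} [TopologicalSpace X] (A : Set C(X, ℝ)) : Set C(X, ℝ) :=
  @closure C(X, ℝ) (uTopology X) A

/-- `C_ψ(X)`: the continuous functions whose support (the closure of the set of points where
the function does not vanish) is a pseudocompact subspace. -/
def cPsi (X : Type*) [TopologicalSpace X] : Set C(X, ℝ) :=
  {f | IsPseudocompactSpace (tsupport f)}

/-- `C^ψ_∞(X)`: the continuous functions `f` such that for each positive integer `n` the set of
points with `|f| ≥ 1/n` is bounded (relatively pseudocompact) in `X`. -/
def cPsiInfty (X : Type*) [TopologicalSpace X] : Set C(X, ℝ) :=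
  {f | ∀ n : ℕ, 0 < n → IsRelPseudocompact {x : X | 1 / (n : ℝ) ≤ |f x|}}

/-- The Stone extension `f* : βX → ℝ ∪ {∞}` of a continuous `f : X → ℝ`, with values in the
one-point compactification of `ℝ`. -/
noncomputable def starExt {X : Type*} [TopologicalSpace X] (f : C(X, ℝ)) :
    StoneCech X → OnePoint ℝ :=
  stoneCechExtend (g := fun x : X => ((f x : ℝ) : OnePoint ℝ))
    (OnePoint.continuous_coe.comp f.continuous)

/-- The Hewitt realcompactification `υX`, as the subspace of `βX` of all points at which every
`f*`, `f ∈ C(X)`, is finite. -/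
def hewitt (X : Type*) [TopologicalSpace X] : Set (StoneCech X) :=
  {p | ∀ f : C(X, ℝ), starExt f p ≠ OnePoint.infty}

/-- The set of all `f ∈ C(X)` with `f*(p) = 0`. -/
def mTilde {X : Type*} [TopologicalSpace X] (p : StoneCech X) : Set C(X, ℝ) :=
  {f | starExt f p = ((0 : ℝ) : OnePoint ℝ)}

end UClosure

namespace UClosure

open Filter Topology

variable {X : Type*} [TopologicalSpace X]

/-! Everything passes through `cPsiInfty X`. By compactness of βX, some `g` is unbounded on `S ⊆ X`
iff `g*` is infinite at a point of the closure of `S` in βX; taking `S = {|f| ≥ 1/n}` links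
boundedness of these sets to `f* = 0` off υX. For the closure, truncation approximates `f` by
functions supported in such sets, and a support that is merely bounded in X is already pseudocompact
(`isPseudocompactSpace_tsupport`). -/

theorem mem_uClosure_iff {A : Set C(X, ℝ)} {f : C(X, ℝ)} :
    f ∈ uClosure A ↔ ∀ ε > 0, ∃ g ∈ A, ∀ x, dist (f x) (g x) < ε := by
  unfold uClosure
  rw [closure_induced (f := fun f : C(X, ℝ) => UniformFun.ofFun (f : X → ℝ)),
    mem_closure_iff_nhds_basis
    (UniformFun.hasBasis_nhds_of_basis X ℝ (UniformFun.ofFun (f : X → ℝ))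
      Metric.uniformity_basis_dist)]
  simp only [Set.exists_mem_image]
  rfl

theorem starExt_stoneCechUnit (f : C(X, ℝ)) (x : X) :
    starExt f (stoneCechUnit x) = ((f x : ℝ) : OnePoint ℝ) :=
  stoneCechExtend_stoneCechUnit _ x

theorem continuous_starExt (f : C(X, ℝ)) : Continuous (starExt f) :=
  continuous_stoneCechExtend _

theorem starExt_mem_of_mem_closure {f : C(X, ℝ)} {S : Set X} {T : Set (OnePoint ℝ)}
    (hT : IsClosed T) (h : ∀ x ∈ S, ((f x : ℝ) : OnePoint ℝ) ∈ T) {p : StoneCech X}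
    (hp : p ∈ closure (stoneCechUnit '' S)) : starExt f p ∈ T := by
  refine closure_minimal ?_ (hT.preimage (continuous_starExt f)) hp
  rintro _ ⟨x, hx, rfl⟩
  rw [Set.mem_preimage, starExt_stoneCechUnit]
  exact h x hx

theorem exists_starExt_eq_infty_of_not_isBounded {g : C(X, ℝ)} {S : Set X}
    (h : ¬ Bornology.IsBounded (g '' S)) :
    ∃ p ∈ closure (stoneCechUnit '' S), starExt g p = OnePoint.infty := by
  by_contra! hne
  set K := starExt g '' closure (stoneCechUnit '' S) with hK
  have hKc : IsCompact K := isClosed_closure.isCompact.image (continuous_starExt g)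
  have hinf : OnePoint.infty ∉ K := by
    rintro ⟨p, hp, hpe⟩
    exact hne p hp hpe
  have hpre : IsCompact ((↑) ⁻¹' K : Set ℝ) :=
    ((OnePoint.isClosed_iff_of_notMem hinf).1 hKc.isClosed).2
  refine h (hpre.isBounded.subset ?_)
  rintro _ ⟨x, hx, rfl⟩
  exact ⟨stoneCechUnit x, subset_closure ⟨x, hx, rfl⟩, starExt_stoneCechUnit g x⟩

theorem isOpen_coe_image_abs_lt (r : ℝ) :
    IsOpen ((↑) '' {t : ℝ | |t| < r} : Set (OnePoint ℝ)) :=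
  OnePoint.isOpenEmbedding_coe.isOpenMap _ (isOpen_lt continuous_abs continuous_const)

theorem starExt_eq_zero_of_mem_cPsiInfty {f : C(X, ℝ)} (hf : f ∈ cPsiInfty X)
    {p : StoneCech X} (hp : p ∉ hewitt X) : starExt f p = ((0 : ℝ) : OnePoint ℝ) := by
  simp only [hewitt, Set.mem_ofPred_eq, not_forall, not_not] at hp
  obtain ⟨g, hg⟩ := hp
  by_contra h0
  obtain ⟨n, hn, hpn⟩ : ∃ n : ℕ, 0 < n ∧
      starExt f p ∉ ((↑) '' {t : ℝ | |t| ≤ 1 / (n : ℝ)} : Set (OnePoint ℝ)) := by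
    induction hv : starExt f p using OnePoint.rec with
    | infty => exact ⟨1, one_pos, by simp⟩
    | coe a =>
      have ha : a ≠ 0 := by
        rintro rfl
        exact h0 hv
      obtain ⟨n, hn⟩ := exists_nat_one_div_lt (abs_pos.2 ha)
      refine ⟨n + 1, n.succ_pos, ?_⟩
      rintro ⟨t, ht, hta⟩
      rw [OnePoint.coe_eq_coe] at hta
      subst hta
      push_cast at ht
      exact absurd hn (not_lt.2 ht)
  set S := {x : X | 1 / (n : ℝ) ≤ |f x|}
  have hclosed : IsClosed ((↑) '' {t : ℝ | |t| ≤ 1 / (n : ℝ)} : Set (OnePoint ℝ)) := by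
    have : IsCompact {t : ℝ | |t| ≤ 1 / (n : ℝ)} := by
      simpa [Metric.closedBall, Real.dist_eq] using isCompact_closedBall (0 : ℝ) (1 / (n : ℝ))
    exact (this.image OnePoint.continuous_coe).isClosed
  -- Near `p` the values of `f*` avoid `[-1/n, 1/n]`, so every point of X there lies in `S`.
  have hpS : p ∈ closure (stoneCechUnit '' S) := by
    rw [mem_closure_iff]
    intro V hV hpV
    obtain ⟨x, hxV, hx⟩ := denseRange_stoneCechUnit.exists_mem_open
      (hV.inter (hclosed.isOpen_compl.preimage (continuous_starExt f))) ⟨p, hpV, hpn⟩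
    refine ⟨_, hxV, x, ?_, rfl⟩
    rw [Set.mem_preimage, starExt_stoneCechUnit] at hx
    by_contra hxS
    have hlt : |f x| < 1 / (n : ℝ) := not_le.1 hxS
    exact hx ⟨f x, hlt.le, rfl⟩
  obtain ⟨R, hR⟩ := (hf n hn g).subset_closedBall 0
  have := starExt_mem_of_mem_closure (f := g)
    ((isCompact_closedBall (0 : ℝ) R).image OnePoint.continuous_coe).isClosed
    (fun x hx => ⟨g x, hR ⟨x, hx, rfl⟩, rfl⟩) hpS
  rw [hg] at this
  obtain ⟨t, -, ht⟩ := this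
  exact OnePoint.coe_ne_infty t ht

theorem mem_cPsiInfty_of_starExt_eq_zero {f : C(X, ℝ)}
    (hf : ∀ p ∉ hewitt X, starExt f p = ((0 : ℝ) : OnePoint ℝ)) : f ∈ cPsiInfty X := by
  intro n hn g
  by_contra hb
  obtain ⟨p, hp, hgp⟩ := exists_starExt_eq_infty_of_not_isBounded hb
  have h0 := hf p fun h => h g hgp
  refine starExt_mem_of_mem_closure (f := f)
    (isOpen_coe_image_abs_lt (1 / (n : ℝ))).isClosed_compl ?_ hp ⟨0, ?_, h0.symm⟩
  · rintro x hx ⟨t, ht, htx⟩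
    rw [OnePoint.coe_eq_coe] at htx
    subst htx
    have hlt : |f x| < 1 / (n : ℝ) := ht
    exact hlt.not_ge hx
  · simpa using hn

theorem uClosure_cPsi_subset_cPsiInfty : uClosure (cPsi X) ⊆ cPsiInfty X := by
  intro f hf n hn h
  obtain ⟨g, hg, hfg⟩ := mem_uClosure_iff.1 hf (1 / (n : ℝ)) (by positivity)
  refine (hg (h.restrict (tsupport g))).subset ?_
  rintro _ ⟨x, hx, rfl⟩
  refine ⟨⟨x, subset_closure fun hgx => ?_⟩, rfl⟩
  have := hfg x
  rw [hgx, Real.dist_eq, sub_zero] at this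
  exact absurd hx (not_le.2 this)

/-- If `φ` is continuous on the support of `g`, then `g * φ`, extended by zero, is continuous. -/
theorem exists_continuousMap_eq_mul_on_tsupport (g : C(X, ℝ)) (φ : C(tsupport g, ℝ)) :
    ∃ H : C(X, ℝ), ∀ x : tsupport g, H x = g x * φ x := by
  classical
  let H : X → ℝ := fun x => if hx : x ∈ tsupport g then g x * φ ⟨x, hx⟩ else 0
  have hH : ∀ x : tsupport g, H x = g x * φ x := fun x => by simp [H]
  have h1 : ContinuousOn H (tsupport g) := by
    rw [continuousOn_iff_continuous_domRestrict]
    have : (tsupport g).domRestrict H = fun x : tsupport g => g x * φ x := funext hH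
    rw [this]
    fun_prop
  -- On the overlap of the two closed pieces `g` vanishes, so the definitions agree.
  have hz : ∀ x ∈ closure (tsupport g)ᶜ, g x = 0 := fun x hx =>
    closure_minimal (t := {x | g x = 0}) (fun y hy => image_eq_zero_of_notMem_tsupport hy)
      (isClosed_eq g.continuous continuous_const) hx
  have h2 : ContinuousOn H (closure (tsupport g)ᶜ) := by
    refine (continuousOn_const (c := (0 : ℝ))).congr fun x hx => ?_
    by_cases hxs : x ∈ tsupport g
    · simpa [hz x hx] using hH ⟨x, hxs⟩
    · simp [H, hxs]
  have h3 := h1.union_of_isClosed h2 (isClosed_tsupport g) isClosed_closure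
  have huniv : tsupport g ∪ closure (tsupport g)ᶜ = Set.univ :=
    Set.eq_univ_of_forall fun x => (em (x ∈ tsupport g)).imp id fun h => subset_closure h
  rw [huniv, continuousOn_univ] at h3
  exact ⟨⟨H, h3⟩, hH⟩

/-- An unbounded `h` on the support need not extend to X, but `g * ψ(|h|)` does, and a suitable `ψ`
keeps it unbounded. -/
theorem isPseudocompactSpace_tsupport {g : C(X, ℝ)} (hg : IsRelPseudocompact (tsupport g)) :
    IsPseudocompactSpace (tsupport g) := by
  intro h
  by_contra hb
  have hbig : ∀ M : ℝ, ∃ y : tsupport g, g y ≠ 0 ∧ M < |h y| := by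
    intro M
    by_contra! hM
    have hdense : ∀ y : tsupport g, |h y| ≤ M := by
      have hd : Dense {y : tsupport g | g y ≠ 0} := by
        rw [Subtype.dense_iff]
        intro x hx
        refine closure_mono ?_ hx
        intro z hz
        exact ⟨⟨z, subset_closure hz⟩, hz, rfl⟩
      have hc : IsClosed {y : tsupport g | |h y| ≤ M} :=
        isClosed_le (by fun_prop) continuous_const
      exact fun y => closure_minimal (fun y hy => hM y hy) hc (hd y)
    refine hb ((Metric.isBounded_closedBall (x := (0 : ℝ)) (r := M)).subset ?_)
    rintro _ ⟨y, rfl⟩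
    simpa using hdense y
  have : Std.Symm fun y z : tsupport g => 1 ≤ dist |h y| |h z| :=
    ⟨fun y z hyz => by rwa [dist_comm]⟩
  obtain ⟨u, hu, hsep⟩ := exists_seq_of_forall_finset_exists'
    (fun y : tsupport g => g y ≠ 0) (fun y z => 1 ≤ dist |h y| |h z|) fun s _ => by
      obtain ⟨M, hM⟩ := (s.image fun y => |h y|).bddAbove
      obtain ⟨y, hy0, hy⟩ := hbig (M + 1)
      refine ⟨y, hy0, fun x hx => ?_⟩
      have : |h x| ≤ M := hM (by simpa using ⟨x, x.2, hx, rfl⟩)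
      rw [dist_comm, Real.dist_eq]
      exact le_trans (by linarith) (le_abs_self _)
  have hemb : IsClosedEmbedding fun n : ℕ => |h (u n)| :=
    Metric.isClosedEmbedding_of_pairwise_le_dist one_pos hsep
  -- Tietze on the closed discrete set of values `|h (u n)|`; dividing by `g (u n)` makes the
  -- product equal `n` at `u n`.
  obtain ⟨ψ, hψ⟩ := ContinuousMap.exists_extension' hemb
    ⟨fun n : ℕ => (n : ℝ) / g (u n), continuous_of_discreteTopology⟩
  obtain ⟨H, hH⟩ := exists_continuousMap_eq_mul_on_tsupport g
    ⟨fun y => ψ |h y|, by fun_prop⟩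
  obtain ⟨R, hR⟩ := (hg H).subset_closedBall 0
  obtain ⟨n, hn⟩ := exists_nat_gt R
  have hval : H (u n) = n := by
    rw [hH]
    have : ψ |h (u n)| = (n : ℝ) / g (u n) := congrFun hψ n
    simp only [ContinuousMap.coe_mk, this]
    exact mul_div_cancel₀ _ (hu n)
  have := hR ⟨u n, (u n).2, hval⟩
  rw [Metric.mem_closedBall, dist_zero_right, Real.norm_natCast] at this
  linarith

theorem cPsiInfty_subset_uClosure_cPsi : cPsiInfty X ⊆ uClosure (cPsi X) := by
  intro f hf
  refine mem_uClosure_iff.2 fun ε hε => ?_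
  obtain ⟨n, hn⟩ := exists_nat_one_div_lt hε
  set δ : ℝ := 1 / ((n : ℝ) + 1) with hδ
  have hδ0 : 0 < δ := by positivity
  -- Subtracting the truncation of `f` to `[-δ, δ]` moves `f` by at most `δ < ε` and kills it where
  -- `|f| < δ`.
  let g : C(X, ℝ) := ⟨fun x => f x - max (-δ) (min (f x) δ), by fun_prop⟩
  have hgf : ∀ x, g x = f x - max (-δ) (min (f x) δ) := fun x => rfl
  have hsub : tsupport g ⊆ {x : X | δ ≤ |f x|} := by
    refine closure_minimal (fun x hx => ?_) (isClosed_le continuous_const (by fun_prop))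
    by_contra hlt
    have hlt' : |f x| < δ := not_le.1 hlt
    obtain ⟨h1, h2⟩ := abs_lt.1 hlt'
    refine hx ?_
    rw [hgf, min_eq_left h2.le, max_eq_right h1.le, sub_self]
  refine ⟨g, isPseudocompactSpace_tsupport fun k => ?_, fun x => ?_⟩
  · have := hf (n + 1) n.succ_pos k
    push_cast at this
    exact this.subset (Set.image_mono hsub)
  · rw [hgf, Real.dist_eq, sub_sub_cancel]
    refine lt_of_le_of_lt (abs_le.2 ⟨le_max_left _ _, max_le (by linarith) (min_le_right _ _)⟩) hn

theorem uClosure_cPsi_eq_cPsiInfty : uClosure (cPsi X) = cPsiInfty X :=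
  uClosure_cPsi_subset_cPsiInfty.antisymm cPsiInfty_subset_uClosure_cPsi

theorem mem_cPsiInfty_iff {f : C(X, ℝ)} :
    f ∈ cPsiInfty X ↔ ∀ p ∉ hewitt X, starExt f p = ((0 : ℝ) : OnePoint ℝ) :=
  ⟨fun hf _ hp => starExt_eq_zero_of_mem_cPsiInfty hf hp, mem_cPsiInfty_of_starExt_eq_zero⟩

end UClosure

theorem mainTheorem11 {X : Type*} [TopologicalSpace X] [T35Space X] :
    UClosure.uClosure (UClosure.cPsi X) = (⋂ p ∈ (UClosure.hewitt X)ᶜ, UClosure.mTilde p) ∧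
    UClosure.uClosure (UClosure.cPsi X) =
      {f : C(X, ℝ) | UClosure.starExt f '' (UClosure.hewitt X)ᶜ ⊆ {((0 : ℝ) : OnePoint ℝ)}} ∧
    UClosure.uClosure (UClosure.cPsi X) = UClosure.cPsiInfty X := by
  rw [UClosure.uClosure_cPsi_eq_cPsiInfty]
  refine ⟨?_, ?_, rfl⟩
  · ext f
    rw [UClosure.mem_cPsiInfty_iff, Set.mem_iInter₂]
    rfl
  · ext f
    rw [UClosure.mem_cPsiInfty_iff, Set.mem_ofPred_eq, Set.image_subset_iff]
    rfl
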